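/- **Corollary 4.3 ($\Phi_3$ formula).** Let $0<I_1<I_2<I_3$ and $l>0$, and put $a=\frac1{I_1}$, $b=\frac1{I_2}$, $c=\frac1{I_3}$. Consider the free rigid body Hamiltonian $H=\frac12\left(\frac{p_1^2}{I_1}+\frac{p_2^2}{I_2}+\frac{p_3^2}{I_3}\right)$ on the sphere $\frac12(p_1^2+p_2^2+p_3^2)=l$ with the symplectic form $$\omega=\frac{dp_1\wedge dp_2}{3p_3}=\frac{dp_2\wedge dp_3}{3p_1}=\frac{dp_3\wedge dp_1}{3p_2}.$$ Let $e$ be one of the two elliptic equilibria $(0,0,\pm\sqrt{2l})$, where $H(e)=\frac{l}{I_3}$. Let $\mathcal H_3$ be a Birkhoff normal form of $H$ around $e$: an analytic function near $0$ with $\mathcal H_3(0)=0$, $\mathcal H_3'(0)\neq0$, such that $H-\frac{l}{I_3}=\mathcal H_3\!\left(\frac{x^2+y^2}{2}\right)$ in some real-analytic local coordinates $(x,y)$ on the sphere centred at $e$ with $\omega=dx\wedge dy$. Let $\Phi_3$ be the inverse of $\mathcal H_3$ near $0$. Then for all $h$ in a neighbourhood of $\frac{l}{I_3}$, with $d=\frac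 hl$, the derivative $\Phi_3'(h)$, i.e. the derivative of $\Phi_3$ at the point $h-\frac l{I_3}$, exists and equals $$\Phi_3'(h)=-\frac{1}{3\pi}\sqrt{\frac2l}\;\frac{1}{\sqrt{(d-a)(c-b)}}\;\mathcal K\!\left(\frac{(d-c)(b-a)}{(d-a)(b-c)}\right)=S(c,b,a,d).$$ Here $\mathcal K(\lambda)=\int_0^1\frac{dx}{\sqrt{(1-x^2)(1-\lambda x^2)}}$ is the complete elliptic integral of the first kind, $$S(a,b,c,d)=-\frac{1}{3\pi}\sqrt{\frac2l}\;\frac{1}{\sqrt{(d-c)(a-b)}}\;\mathcal K\!\left(\frac{(d-a)(b-c)}{(d-c)(b-a)}\right),$$ and the square root of a product in these two formulae is taken in the branch $\sqrt{uv}=\sqrt u\,\sqrt v$ with principal complex roots of the real factors $u$ and $v$. In particular $\sqrt{(d-a)(c-b)}=\sqrt{d-a}\,\sqrt{c-b}=-\sqrt{(a-d)(b-c)}<0$ in the formula for $\Phi_3'$, both factors being negative there, so that $\Phi_3'(h)=\frac{1}{3\pi}\sqrt{\frac2l}\,\frac{1}{\sqrt{(a-d)(b-c)}}\,\mathcal K\!\left(\frac{(d-c)(b-a)}{(d-a)(b-c)}\right)>0$.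 -/

import Mathlib

open Filter Topology

noncomputable section

namespace FreeRigidBody

/-- The Casimir function `L(P) = (p₁² + p₂² + p₃²) / 2`. -/
def casimir (p : Fin 3 → ℝ) : ℝ := (p 0 ^ 2 + p 1 ^ 2 + p 2 ^ 2) / 2

/-- The Hamiltonian `H(P) = (p₁² / I₁ + p₂² / I₂ + p₃² / I₃) / 2`. -/
def hamiltonian (I₁ I₂ I₃ : ℝ) (p : Fin 3 → ℝ) : ℝ :=
  (p 0 ^ 2 / I₁ + p 1 ^ 2 / I₂ + p 2 ^ 2 / I₃) / 2

/-- The orbit symplectic form `ω` on the sphere `L = l`, evaluated at `p` on two tangent vectors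
`v`, `w`, in the coordinate-free form `det (p, v, w) / (6 l)`. By `orbitForm_eq` below it is
`dp₁ ∧ dp₂ / (3 p₃) = dp₂ ∧ dp₃ / (3 p₁) = dp₃ ∧ dp₁ / (3 p₂)`. -/
def orbitForm (l : ℝ) (p v w : Fin 3 → ℝ) : ℝ :=
  (p 0 * (v 1 * w 2 - v 2 * w 1) + p 1 * (v 2 * w 0 - v 0 * w 2)
    + p 2 * (v 0 * w 1 - v 1 * w 0)) / (6 * l)

/-- On vectors tangent to the sphere `L = l`, the form `orbitForm` is given by each of the three
usual coordinate expressions, wherever its denominator does not vanish. -/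
theorem orbitForm_eq {l : ℝ} (hl : 0 < l) {p v w : Fin 3 → ℝ} (hp : casimir p = l)
    (hv : p 0 * v 0 + p 1 * v 1 + p 2 * v 2 = 0) (hw : p 0 * w 0 + p 1 * w 1 + p 2 * w 2 = 0) :
    (p 2 ≠ 0 → orbitForm l p v w = (v 0 * w 1 - v 1 * w 0) / (3 * p 2)) ∧
    (p 0 ≠ 0 → orbitForm l p v w = (v 1 * w 2 - v 2 * w 1) / (3 * p 0)) ∧
    (p 1 ≠ 0 → orbitForm l p v w = (v 2 * w 0 - v 0 * w 2) / (3 * p 1)) := by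
  unfold casimir at hp
  subst hp
  unfold orbitForm
  have h6 : 6 * ((p 0 ^ 2 + p 1 ^ 2 + p 2 ^ 2) / 2) ≠ 0 := by positivity
  refine ⟨fun h => ?_, fun h => ?_, fun h => ?_⟩
  · rw [div_eq_div_iff h6 (mul_ne_zero three_ne_zero h)]
    linear_combination (3 * (p 0 * w 1 - p 1 * w 0)) * (-hv) + (3 * (p 0 * v 1 - p 1 * v 0)) * hw
  · rw [div_eq_div_iff h6 (mul_ne_zero three_ne_zero h)]
    linear_combination (3 * (p 1 * w 2 - p 2 * w 1)) * (-hv) + (3 * (p 1 * v 2 - p 2 * v 1)) * hw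
  · rw [div_eq_div_iff h6 (mul_ne_zero three_ne_zero h)]
    linear_combination (3 * (p 2 * w 0 - p 0 * w 2)) * (-hv) + (3 * (p 2 * v 0 - p 0 * v 2)) * hw

/-- `IsDarbouxParam l P e`: the map `P` parametrises a neighbourhood of the point `e` of the sphere
`L = l` by analytic Darboux coordinates `(x, y)` centred at `e`, i.e. `ω = dx ∧ dy`. (Since `ω` is
non-degenerate, `P` is automatically an immersion near the origin, hence the inverse of a local
coordinate system on the sphere.) -/
structure IsDarbouxParam (l : ℝ) (P : ℝ × ℝ → Fin 3 → ℝ) (e : Fin 3 → ℝ) : Prop where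
  analyticAt : AnalyticAt ℝ P (0, 0)
  map_zero : P (0, 0) = e
  casimir_eq : ∀ᶠ z in 𝓝 ((0, 0) : ℝ × ℝ), casimir (P z) = l
  pullback_eq : ∀ᶠ z in 𝓝 ((0, 0) : ℝ × ℝ),
    orbitForm l (P z) (fderiv ℝ P z (1, 0)) (fderiv ℝ P z (0, 1)) = 1

/-- `IsBirkhoffNormalForm I₁ I₂ I₃ l e N`: the invertible analytic germ `N` at `0` is a Birkhoff
normal form, around the elliptic equilibrium `e`, of the free rigid body reduced to the sphere
`L = l`: in suitable Darboux coordinates `(x, y)` centred at `e`,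
`H - H(e) = N ((x² + y²) / 2)`. -/
def IsBirkhoffNormalForm (I₁ I₂ I₃ l : ℝ) (e : Fin 3 → ℝ) (N : ℝ → ℝ) : Prop :=
  AnalyticAt ℝ N 0 ∧ N 0 = 0 ∧ deriv N 0 ≠ 0 ∧
    ∃ P : ℝ × ℝ → Fin 3 → ℝ, IsDarbouxParam l P e ∧
      ∀ᶠ z in 𝓝 ((0, 0) : ℝ × ℝ),
        hamiltonian I₁ I₂ I₃ (P z) - hamiltonian I₁ I₂ I₃ e = N ((z.1 ^ 2 + z.2 ^ 2) / 2)

/-- `Φ` is the inverse of the germ `N` (with `N 0 = 0`) near `0`. -/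
def IsLocalInverse (N Φ : ℝ → ℝ) : Prop :=
  Φ 0 = 0 ∧ (∀ᶠ u in 𝓝 (0 : ℝ), Φ (N u) = u) ∧ ∀ᶠ t in 𝓝 (0 : ℝ), N (Φ t) = t

/-- The complete elliptic integral of the first kind,
`K(m) = ∫₀¹ dx / √((1 - x²) (1 - m x²))`, for real `m < 1`. -/
def ellipticK (m : ℝ) : ℝ :=
  ∫ x in (0 : ℝ)..1, 1 / Real.sqrt ((1 - x ^ 2) * (1 - m * x ^ 2))

/-- The branch of `√(x y)` given by `√x √y`, with principal complex square roots. -/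
def rootMul (x y : ℝ) : ℂ := Complex.sqrt x * Complex.sqrt y

/-- For two non-negative factors `rootMul` is the usual square root of the product. -/
theorem rootMul_of_nonneg {x y : ℝ} (hx : 0 ≤ x) (hy : 0 ≤ y) :
    rootMul x y = (Real.sqrt (x * y) : ℂ) := by
  have h : ∀ t : ℝ, 0 ≤ t → Complex.sqrt (t : ℂ) = (Real.sqrt t : ℂ) := fun t ht => by
    rw [Complex.sqrt_of_nonneg (by exact_mod_cast ht)]; simp
  rw [rootMul, h x hx, h y hy, Real.sqrt_mul hx]
  push_cast
  rfl

/-- For two negative factors `rootMul` is the negative square root of the (positive) product. -/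
theorem rootMul_of_neg {x y : ℝ} (hx : x < 0) (hy : y < 0) :
    rootMul x y = -(Real.sqrt (x * y) : ℂ) := by
  have h : ∀ t : ℝ, t < 0 → Complex.sqrt (t : ℂ) = Complex.I * (Real.sqrt (-t) : ℂ) :=
    fun t ht => by
      have h1 : (|t| + t) / 2 = 0 := by rw [abs_of_neg ht]; ring
      have h2 : (|t| - t) / 2 = -t := by rw [abs_of_neg ht]; ring
      rw [Complex.sqrt_eq_real_add_ite, Complex.norm_real, Complex.ofReal_re, Complex.ofReal_im,
        Real.norm_eq_abs, h1, h2]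
      simp [mul_comm]
  rw [rootMul, h x hx, h y hy, ← neg_mul_neg x y, Real.sqrt_mul (by linarith)]
  push_cast
  linear_combination (Real.sqrt (-x) : ℂ) * (Real.sqrt (-y) : ℂ) * Complex.I_mul_I

/-- The function
`S(a, b, c, d) = -(1 / (3π)) √(2 / l) (1 / √((d - c) (a - b))) K((d - a) (b - c) / ((d - c) (b - a)))`,
with the root `√((d - c) (a - b))` read as `√(d - c) √(a - b)`. -/
def periodS (l a b c d : ℝ) : ℂ :=
  -(1 / (3 * (Real.pi : ℂ))) * (Real.sqrt (2 / l) : ℂ) * (1 / rootMul (d - c) (a - b))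
    * (ellipticK ((d - a) * (b - c) / ((d - c) * (b - a))) : ℂ)

end FreeRigidBody

end

/-! Put A = a - c and B = b - c, both positive. Eliminating p₃² on the sphere gives H - l/I₃ = (A
p₁² + B p₂²)/2, so in the coordinates w = (√A p₁, √B p₂) the energy is itself |w|²/2
(`energyCoord_action`). A normal form makes it N(|z|²/2) in Darboux coordinates z. Hence z ↦ w
carries the disc of action u onto that of action N(u), and comparing symplectic areas gives 2πu =
∫₀^{N(u)} T(s) ds with T = `levelPeriod` (`eventually_area_actionDisc`,
`setIntegral_disc_eq_integral_action`). Areas replace any study of the flow.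

Differentiating, T(N(u)) N'(u) = 2π for u > 0. As e minimises H, energies below l/I₃ are not
attained and u < 0 has no geometric meaning; the identity theorem extends the relation, which is why
T, and so `ellipticK` at 0, must be analytic. Inverting, Φ' = T/(2π)
(`IsLocalInverse.eventually_hasDerivAt`), and T is a complete elliptic integral
(`levelPeriod_eq_ellipticK`). -/

noncomputable section

namespace FreeRigidBody

open MeasureTheory Set

/-! ### Complete elliptic integral: trigonometric form and analyticity at 0. -/

/-- Legendre's trigonometric form of the complete elliptic integral of the first kind. -/
theorem ellipticK_eq_integral_sin (m : ℝ) :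
    ellipticK m = ∫ θ in (0 : ℝ)..(Real.pi / 2), 1 / Real.sqrt (1 - m * Real.sin θ ^ 2) := by
  have hpi := Real.pi_pos
  have himg : Real.sin '' Ioo 0 (Real.pi / 2) = Ioo 0 1 := by
    ext y
    constructor
    · rintro ⟨x, ⟨h0, h1⟩, rfl⟩
      refine ⟨Real.sin_pos_of_pos_of_lt_pi h0 (by linarith), ?_⟩
      have := Real.sin_lt_sin_of_lt_of_le_pi_div_two (by linarith) le_rfl h1
      simpa using this
    · rintro ⟨h0, h1⟩
      exact ⟨Real.arcsin y, ⟨Real.arcsin_pos.2 h0, Real.arcsin_lt_pi_div_two.2 h1⟩,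
        Real.sin_arcsin (by linarith) h1.le⟩
  have hinj : InjOn Real.sin (Ioo 0 (Real.pi / 2)) :=
    Real.strictMonoOn_sin.injOn.mono
      (Ioo_subset_Icc_self.trans (Icc_subset_Icc_left (by linarith)))
  -- Substitute x = sin θ. This change of variables needs no integrability, so the singular endpoint
  -- and the size of m do not matter.
  have key := integral_image_eq_integral_abs_deriv_smul measurableSet_Ioo
    (fun x _ => (Real.hasDerivAt_sin x).hasDerivWithinAt) hinj
    (fun x => 1 / Real.sqrt ((1 - x ^ 2) * (1 - m * x ^ 2)))
  rw [himg] at key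
  rw [ellipticK, intervalIntegral.integral_of_le zero_le_one,
    intervalIntegral.integral_of_le (by positivity), integral_Ioc_eq_integral_Ioo,
    integral_Ioc_eq_integral_Ioo, key]
  refine setIntegral_congr_fun measurableSet_Ioo fun x hx => ?_
  have hc : 0 < Real.cos x := Real.cos_pos_of_mem_Ioo ⟨by linarith [hx.1], hx.2⟩
  have h1 : 1 - Real.sin x ^ 2 = Real.cos x ^ 2 := by linarith [Real.sin_sq_add_cos_sq x]
  simp only [smul_eq_mul]
  rw [h1, Real.sqrt_mul (sq_nonneg _), Real.sqrt_sq hc.le, abs_of_pos hc]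
  field_simp

/-- Keeps the base of the power off the branch cut and its norm at least 1/2. -/
theorem half_le_re_one_sub_mul_sin_sq {z : ℂ} (hz : ‖z‖ < 1 / 2) (θ : ℝ) :
    1 / 2 ≤ (1 - z * ((Real.sin θ ^ 2 : ℝ) : ℂ)).re := by
  have h1 : z.re ≤ 1 / 2 := (Complex.re_le_norm z).trans hz.le
  have h2 : 0 ≤ Real.sin θ ^ 2 := sq_nonneg _
  have h3 : Real.sin θ ^ 2 ≤ 1 := Real.sin_sq_le_one θ
  rw [Complex.sub_re, Complex.re_mul_ofReal, Complex.one_re]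
  nlinarith

theorem continuous_one_sub_mul_sin_sq_cpow {z : ℂ} (hz : ‖z‖ < 1 / 2) (p : ℂ) :
    Continuous fun θ : ℝ => (1 - z * ((Real.sin θ ^ 2 : ℝ) : ℂ)) ^ p := by
  refine Continuous.cpow (by fun_prop) continuous_const fun θ => Or.inl ?_
  linarith [half_le_re_one_sub_mul_sin_sq hz θ]

/-- The complex elliptic integral is holomorphic near the origin. -/
theorem analyticAt_integral_one_sub_mul_sin_sq_cpow :
    AnalyticAt ℂ (fun z : ℂ => ∫ θ in (0 : ℝ)..(Real.pi / 2),
      (1 - z * ((Real.sin θ ^ 2 : ℝ) : ℂ)) ^ (((-1 / 2 : ℝ)) : ℂ)) 0 := by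
  have hball : Metric.ball (0 : ℂ) (1 / 2) ∈ 𝓝 (0 : ℂ) := Metric.ball_mem_nhds _ (by norm_num)
  refine DifferentiableOn.analyticAt (s := Metric.ball 0 (1 / 2)) (fun z₀ hz₀ => ?_) hball
  have hnhds := Metric.isOpen_ball.mem_nhds hz₀
  have hn : ∀ z ∈ Metric.ball (0 : ℂ) (1 / 2), ‖z‖ < 1 / 2 := fun z hz => by simpa using hz
  refine DifferentiableAt.differentiableWithinAt ?_
  -- The derivative contains the power -3/2 of a base of norm at least 1/2, which gives the constant
  -- bound; the other factors have norm at most 1.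
  refine (intervalIntegral.hasDerivAt_integral_of_dominated_loc_of_deriv_le (μ := volume)
    (F' := fun z θ => (((-1 / 2 : ℝ)) : ℂ) *
      (1 - z * ((Real.sin θ ^ 2 : ℝ) : ℂ)) ^ ((((-1 / 2 : ℝ)) : ℂ) - 1) *
        (-((Real.sin θ ^ 2 : ℝ) : ℂ)))
    (bound := fun _ => (1 / 2 : ℝ) ^ (-3 / 2 : ℝ)) hnhds ?_ ?_ ?_ ?_ ?_ ?_).2.differentiableAt
  · filter_upwards [hnhds] with z hz
    exact (continuous_one_sub_mul_sin_sq_cpow (hn z hz) _).aestronglyMeasurable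
  · exact (continuous_one_sub_mul_sin_sq_cpow (hn _ hz₀) _).intervalIntegrable _ _
  · refine Continuous.aestronglyMeasurable ?_
    exact (continuous_const.mul (continuous_one_sub_mul_sin_sq_cpow (hn _ hz₀) _)).mul
      (by fun_prop)
  · refine ae_of_all _ fun θ _ z hz => ?_
    have hre := half_le_re_one_sub_mul_sin_sq (hn z hz) θ
    have hexp : (((-1 / 2 : ℝ)) : ℂ) - 1 = ((-3 / 2 : ℝ) : ℂ) := by push_cast; norm_num
    have h1 : ‖(1 - z * ((Real.sin θ ^ 2 : ℝ) : ℂ)) ^ ((-3 / 2 : ℝ) : ℂ)‖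
        ≤ (1 / 2 : ℝ) ^ (-3 / 2 : ℝ) := by
      rw [Complex.norm_cpow_real]
      exact Real.rpow_le_rpow_of_nonpos (by norm_num) (hre.trans (Complex.re_le_norm _))
        (by norm_num)
    rw [hexp, norm_mul, norm_mul, norm_neg, Complex.norm_real, Complex.norm_real,
      Real.norm_of_nonneg (sq_nonneg (Real.sin θ)), Real.norm_eq_abs]
    have h2 : |(-1 / 2 : ℝ)| ≤ 1 := by norm_num [abs_of_neg]
    have h3 : Real.sin θ ^ 2 ≤ 1 := Real.sin_sq_le_one θ
    calc _ ≤ 1 * ((1 / 2 : ℝ) ^ (-3 / 2 : ℝ)) * 1 := by gcongr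
      _ = _ := by ring
  · exact intervalIntegrable_const
  · refine ae_of_all _ fun θ _ z hz => ?_
    have hre := half_le_re_one_sub_mul_sin_sq (hn z hz) θ
    have hd : HasDerivAt (fun z : ℂ => 1 - z * ((Real.sin θ ^ 2 : ℝ) : ℂ))
        (-((Real.sin θ ^ 2 : ℝ) : ℂ)) z := by
      simpa only [one_mul, id] using
        ((hasDerivAt_id z).mul_const ((Real.sin θ ^ 2 : ℝ) : ℂ)).const_sub 1
    exact hd.cpow_const (Or.inl (by linarith))

/-- Near 0 this is the real part, on the real axis, of a holomorphic function. -/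
theorem analyticAt_ellipticK_zero : AnalyticAt ℝ ellipticK 0 := by
  have h := analyticAt_integral_one_sub_mul_sin_sq_cpow
  have hre : AnalyticAt ℝ (fun m : ℝ => (∫ θ in (0 : ℝ)..(Real.pi / 2),
      (1 - (m : ℂ) * ((Real.sin θ ^ 2 : ℝ) : ℂ)) ^ (((-1 / 2 : ℝ)) : ℂ)).re) 0 := by
    exact AnalyticAt.re_ofReal (x := 0) (by rw [Complex.ofReal_zero]; exact h)
  refine hre.congr ?_
  filter_upwards [Metric.ball_mem_nhds (0 : ℝ) (by norm_num : (0 : ℝ) < 1 / 2)] with m hm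
  have hm' : |m| < 1 / 2 := by simpa using hm
  have hint : ∀ θ : ℝ, (1 - (m : ℂ) * ((Real.sin θ ^ 2 : ℝ) : ℂ)) ^ (((-1 / 2 : ℝ)) : ℂ)
      = ((1 / Real.sqrt (1 - m * Real.sin θ ^ 2) : ℝ) : ℂ) := by
    intro θ
    have hpos : 0 ≤ 1 - m * Real.sin θ ^ 2 := by
      have := half_le_re_one_sub_mul_sin_sq (z := (m : ℂ)) (by simpa using hm') θ
      rw [Complex.sub_re, Complex.re_mul_ofReal, Complex.one_re, Complex.ofReal_re] at this
      linarith
    rw [show (-1 / 2 : ℝ) = -(1 / 2) by ring, Real.sqrt_eq_rpow, one_div (_ ^ _),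
      ← Real.rpow_neg hpos, Complex.ofReal_cpow hpos]
    push_cast
    rfl
  simp only [hint]
  rw [intervalIntegral.integral_ofReal, Complex.ofReal_re, ellipticK_eq_integral_sin]

/-! ### The period integral over a level curve. -/

/-- An integral over a full turn of a function of `sin²` is four times that over a quarter turn. -/
theorem integral_comp_sin_sq {f : ℝ → ℝ} (hf : Continuous fun θ => f (Real.sin θ ^ 2)) :
    ∫ θ in (-Real.pi)..Real.pi, f (Real.sin θ ^ 2)
      = 4 * ∫ θ in (0 : ℝ)..(Real.pi / 2), f (Real.sin θ ^ 2) := by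
  have hi : ∀ a b, IntervalIntegrable (fun θ => f (Real.sin θ ^ 2)) volume a b :=
    fun a b => hf.intervalIntegrable a b
  have h1 : ∫ θ in (-Real.pi)..0, f (Real.sin θ ^ 2) = ∫ θ in (0 : ℝ)..Real.pi,
      f (Real.sin θ ^ 2) := by
    have := intervalIntegral.integral_comp_neg (a := 0) (b := Real.pi)
      (fun θ => f (Real.sin θ ^ 2))
    simpa using this.symm
  have h2 : ∫ θ in (Real.pi / 2)..Real.pi, f (Real.sin θ ^ 2) = ∫ θ in (0 : ℝ)..(Real.pi / 2),
      f (Real.sin θ ^ 2) := by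
    have := intervalIntegral.integral_comp_sub_left (a := 0) (b := Real.pi / 2)
      (fun θ => f (Real.sin θ ^ 2)) Real.pi
    simp only [Real.sin_pi_sub, sub_zero] at this
    rw [this]
    congr 1
    ring
  rw [← intervalIntegral.integral_add_adjacent_intervals (hi _ 0) (hi 0 _), h1,
    ← intervalIntegral.integral_add_adjacent_intervals (hi 0 (Real.pi / 2)) (hi _ Real.pi), h2]
  ring

/-- The integral over the angle of the symplectic density `1 / (3 √(A B) |p₃|)` along the level
curve `A p₁² + B p₂² = 2 s` of the sphere of radius `√(2 l)`. -/
def levelPeriod (A B l s : ℝ) : ℝ :=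
  ∫ θ in (-Real.pi)..Real.pi,
    1 / (3 * Real.sqrt (A * B)
      * Real.sqrt (2 * l - 2 * s * (Real.cos θ ^ 2 / A + Real.sin θ ^ 2 / B)))

/-- With cos² = 1 - sin² the radicand factors as (2l - 2s/A)(1 - m sin²). It is positive, being
twice a convex combination of l - s/A and l - s/B. The sign of s is free. -/
theorem levelPeriod_eq_ellipticK {A B l s : ℝ} (hA : 0 < A) (hB : 0 < B) (hsA : s < l * A)
    (hsB : s < l * B) :
    levelPeriod A B l s = 4 / (3 * Real.sqrt (A * B) * Real.sqrt (2 * l - 2 * s / A))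
      * ellipticK (s * (1 / B - 1 / A) / (l - s / A)) := by
  have h1 : 0 < l - s / A := by
    have : s / A < l := by rwa [div_lt_iff₀ hA]
    linarith
  have h2 : 0 < l - s / B := by
    have : s / B < l := by rwa [div_lt_iff₀ hB]
    linarith
  set m := s * (1 / B - 1 / A) / (l - s / A) with hm
  have hfac : ∀ y : ℝ, 2 * l - 2 * s * ((1 - y) / A + y / B) = (2 * l - 2 * s / A) * (1 - m * y) := by
    intro y
    have h3 : m * (l - s / A) = s * (1 / B - 1 / A) := div_mul_cancel₀ _ h1.ne'
    linear_combination (2 * y) * h3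
  have hpos : ∀ θ : ℝ, 0 < 1 - m * Real.sin θ ^ 2 := by
    intro θ
    have h3 := hfac (Real.sin θ ^ 2)
    have h4 : 0 < 2 * l - 2 * s * ((1 - Real.sin θ ^ 2) / A + Real.sin θ ^ 2 / B) := by
      have h5 : 2 * l - 2 * s * ((1 - Real.sin θ ^ 2) / A + Real.sin θ ^ 2 / B)
          = 2 * ((1 - Real.sin θ ^ 2) * (l - s / A) + Real.sin θ ^ 2 * (l - s / B)) := by ring
      rw [h5]
      have h6 : 0 ≤ Real.sin θ ^ 2 := sq_nonneg _
      have h7 : Real.sin θ ^ 2 ≤ 1 := Real.sin_sq_le_one θ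
      rcases h6.eq_or_lt with h | h
      · rw [← h]; linarith
      · have := mul_pos h h2
        have := mul_nonneg (sub_nonneg.2 h7) h1.le
        linarith
    rw [h3] at h4
    refine pos_of_mul_pos_right h4 ?_
    rw [mul_div_assoc]
    linarith
  have hint : ∀ θ : ℝ, 1 / (3 * Real.sqrt (A * B)
      * Real.sqrt (2 * l - 2 * s * (Real.cos θ ^ 2 / A + Real.sin θ ^ 2 / B)))
      = 1 / (3 * Real.sqrt (A * B) * Real.sqrt (2 * l - 2 * s / A))
        * (1 / Real.sqrt (1 - m * Real.sin θ ^ 2)) := by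
    intro θ
    rw [Real.cos_sq', hfac, Real.sqrt_mul (x := 2 * l - 2 * s / A)
      (by rw [mul_div_assoc]; linarith)]
    rw [div_mul_div_comm, one_mul, mul_assoc (3 * Real.sqrt (A * B))]
  unfold levelPeriod
  simp only [hint]
  rw [intervalIntegral.integral_const_mul, integral_comp_sin_sq
    (f := fun y => 1 / Real.sqrt (1 - m * y)), ellipticK_eq_integral_sin]
  · ring
  · refine continuous_const.div (by fun_prop) fun θ => ?_
    exact (Real.sqrt_pos.2 (hpos θ)).ne'

/-- The parameter of `ellipticK` in the closed form vanishes at s = 0, so analyticity of `ellipticK`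
at 0 suffices. -/
theorem analyticAt_levelPeriod {A B l : ℝ} (hA : 0 < A) (hB : 0 < B) (hl : 0 < l) :
    AnalyticAt ℝ (levelPeriod A B l) 0 := by
  have hsqrt : AnalyticAt ℝ Real.sqrt (2 * l - 2 * 0 / A) :=
    (Real.contDiffAt_sqrt (n := ⊤) (by simp [hl.ne'])).analyticAt
  have hlin : AnalyticAt ℝ (fun s : ℝ => 2 * l - 2 * s / A) 0 := by fun_prop
  have hden : AnalyticAt ℝ (fun s : ℝ => 3 * Real.sqrt (A * B)
      * Real.sqrt (2 * l - 2 * s / A)) 0 :=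
    analyticAt_const.mul (hsqrt.comp_of_eq hlin rfl)
  have hm : AnalyticAt ℝ (fun s : ℝ => s * (1 / B - 1 / A) / (l - s / A)) 0 := by
    refine AnalyticAt.div (by fun_prop) (by fun_prop) (by simp [hl.ne'])
  have hall := (analyticAt_const (v := (4 : ℝ)).div hden (by
    have := Real.sqrt_pos.2 (mul_pos hA hB)
    have := Real.sqrt_pos.2 (mul_pos two_pos hl)
    simp only [mul_zero, zero_div, sub_zero]
    positivity)).mul (analyticAt_ellipticK_zero.comp_of_eq hm (by simp))
  refine hall.congr ?_
  filter_upwards [Iio_mem_nhds (mul_pos hl hA), Iio_mem_nhds (mul_pos hl hB)] with s h1 h2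
  exact (levelPeriod_eq_ellipticK hA hB h1 h2).symm

/-! ### Discs, actions and areas in the plane. -/

/-- Integration over a disc in polar coordinates. -/
theorem setIntegral_disc {F : ℝ × ℝ → ℝ} {R : ℝ} (hR : 0 ≤ R)
    (hF : ContinuousOn F {z | z.1 ^ 2 + z.2 ^ 2 ≤ R ^ 2}) :
    ∫ z in {z : ℝ × ℝ | z.1 ^ 2 + z.2 ^ 2 < R ^ 2}, F z
      = ∫ r in (0 : ℝ)..R, r * ∫ θ in (-Real.pi)..Real.pi,
          F (r * Real.cos θ, r * Real.sin θ) := by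
  have hsq : ∀ r θ : ℝ, (r * Real.cos θ) ^ 2 + (r * Real.sin θ) ^ 2 = r ^ 2 := fun r θ => by
    linear_combination r ^ 2 * Real.sin_sq_add_cos_sq θ
  have hmeas : MeasurableSet {z : ℝ × ℝ | z.1 ^ 2 + z.2 ^ 2 < R ^ 2} :=
    (isOpen_lt (by fun_prop) (by fun_prop)).measurableSet
  rw [← integral_indicator hmeas, ← integral_comp_polarCoord_symm]
  have hset : polarCoord.target ∩ (Iio R ×ˢ univ) = Ioo 0 R ×ˢ Ioo (-Real.pi) Real.pi := by
    ext ⟨r, θ⟩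
    simp [polarCoord_target]
    tauto
  have hint : ∫ p in polarCoord.target, p.1 • ({z : ℝ × ℝ | z.1 ^ 2 + z.2 ^ 2 < R ^ 2}.indicator F
      (polarCoord.symm p)) = ∫ p in Ioo 0 R ×ˢ Ioo (-Real.pi) Real.pi,
        p.1 * F (p.1 * Real.cos p.2, p.1 * Real.sin p.2) := by
    rw [← hset, ← setIntegral_indicator (measurableSet_Iio.prod MeasurableSet.univ)]
    refine setIntegral_congr_fun polarCoord.open_target.measurableSet fun p hp => ?_
    have hp0 : 0 < p.1 := hp.1
    have hiff : polarCoord.symm p ∈ {z : ℝ × ℝ | z.1 ^ 2 + z.2 ^ 2 < R ^ 2} ↔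
        p ∈ Iio R ×ˢ (univ : Set ℝ) := by
      simp only [polarCoord_symm_apply, mem_ofPred_eq, hsq, mem_prod, mem_Iio, mem_univ, and_true]
      exact sq_lt_sq₀ hp0.le hR
    by_cases h : p ∈ Iio R ×ˢ (univ : Set ℝ)
    · simp only [indicator_of_mem h]
      rw [indicator_of_mem (hiff.2 h), polarCoord_symm_apply, smul_eq_mul]
    · simp only [indicator_of_notMem h]
      rw [indicator_of_notMem (mt hiff.1 h), smul_zero]
  have hcont : ContinuousOn (fun p : ℝ × ℝ => p.1 * F (p.1 * Real.cos p.2, p.1 * Real.sin p.2))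
      (Icc 0 R ×ˢ Icc (-Real.pi) Real.pi) := by
    refine continuousOn_fst.mul (hF.comp (by fun_prop) fun p hp => ?_)
    simp only [mem_ofPred_eq, hsq]
    exact pow_le_pow_left₀ hp.1.1 hp.1.2 2
  rw [hint, Measure.volume_eq_prod, setIntegral_prod, intervalIntegral.integral_of_le hR,
    integral_Ioc_eq_integral_Ioo]
  · refine setIntegral_congr_fun measurableSet_Ioo fun r _ => ?_
    simp only
    rw [integral_const_mul, intervalIntegral.integral_of_le (by linarith [Real.pi_pos]),
      integral_Ioc_eq_integral_Ioo]
  · exact (hcont.integrableOn_compact (isCompact_Icc.prod isCompact_Icc)).mono_set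
      (prod_mono Ioo_subset_Icc_self Ioo_subset_Icc_self)

/-- The open disc of action `T`, i.e. of radius `√(2 T)`, in the plane. -/
def actionDisc (T : ℝ) : Set (ℝ × ℝ) := {z | (z.1 ^ 2 + z.2 ^ 2) / 2 < T}

/-- Integration over a disc, in terms of the action variable `s = r² / 2`. -/
theorem setIntegral_disc_eq_integral_action {F : ℝ × ℝ → ℝ} {G : ℝ → ℝ} {T : ℝ} (hT : 0 ≤ T)
    (hF : ContinuousOn F {z | (z.1 ^ 2 + z.2 ^ 2) / 2 ≤ T}) (hG : ContinuousOn G (Icc 0 T))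
    (hFG : ∀ r, ∫ θ in (-Real.pi)..Real.pi, F (r * Real.cos θ, r * Real.sin θ) = G (r ^ 2 / 2)) :
    ∫ z in actionDisc T, F z = ∫ s in (0 : ℝ)..T, G s := by
  have hR : Real.sqrt (2 * T) ^ 2 = 2 * T := Real.sq_sqrt (by linarith)
  have hle : {z : ℝ × ℝ | (z.1 ^ 2 + z.2 ^ 2) / 2 ≤ T}
      = {z | z.1 ^ 2 + z.2 ^ 2 ≤ Real.sqrt (2 * T) ^ 2} := by
    ext z
    simp only [mem_ofPred_eq, hR]
    constructor <;> intro h <;> linarith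
  have hlt : actionDisc T = {z | z.1 ^ 2 + z.2 ^ 2 < Real.sqrt (2 * T) ^ 2} := by
    ext z
    simp only [actionDisc, mem_ofPred_eq, hR]
    constructor <;> intro h <;> linarith
  rw [hle] at hF
  rw [hlt, setIntegral_disc (Real.sqrt_nonneg _) hF]
  simp only [hFG]
  have hsub := intervalIntegral.integral_comp_mul_deriv'' (a := 0) (b := Real.sqrt (2 * T))
    (f := fun r => r ^ 2 / 2) (f' := fun r => r) (g := G) (by fun_prop)
    (fun r _ => by
      have := ((hasDerivAt_pow 2 r).div_const 2).hasDerivWithinAt (s := Ioi r)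
      simpa using this) (by fun_prop) (hG.mono ?_)
  · simp only [Function.comp_apply] at hsub
    rw [hR] at hsub
    simp only [ne_eq, OfNat.ofNat_ne_zero, not_false_eq_true, zero_pow, zero_div,
      mul_div_cancel_left₀] at hsub
    rw [← hsub]
    exact intervalIntegral.integral_congr fun r _ => mul_comm _ _
  · rintro _ ⟨r, hr, rfl⟩
    rw [uIcc_of_le (Real.sqrt_nonneg _)] at hr
    have := pow_le_pow_left₀ hr.1 hr.2 2
    refine ⟨by positivity, ?_⟩
    simp only
    linarith

theorem isOpen_actionDisc (T : ℝ) : IsOpen (actionDisc T) :=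
  isOpen_lt (by fun_prop) continuous_const

theorem actionDisc_mono {S T : ℝ} (h : S ≤ T) : actionDisc S ⊆ actionDisc T :=
  fun _ hz => lt_of_lt_of_le hz h

theorem exists_actionDisc_subset {S : Set (ℝ × ℝ)} (hS : S ∈ 𝓝 (0 : ℝ × ℝ)) :
    ∃ δ > 0, actionDisc δ ⊆ S := by
  obtain ⟨ε, hε, hsub⟩ := Metric.mem_nhds_iff.1 hS
  -- Action ε²/2 means Euclidean radius ε, and that disc lies in the sup-norm ball of radius ε.
  refine ⟨ε ^ 2 / 2, by positivity, fun z hz => hsub ?_⟩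
  have hz' : (z.1 ^ 2 + z.2 ^ 2) / 2 < ε ^ 2 / 2 := hz
  rw [mem_ball_zero_iff, Prod.norm_def, max_lt_iff, Real.norm_eq_abs, Real.norm_eq_abs]
  exact ⟨abs_lt_of_sq_lt_sq (by linarith [sq_nonneg z.2]) hε.le,
    abs_lt_of_sq_lt_sq (by linarith [sq_nonneg z.1]) hε.le⟩

theorem exists_strictMonoOn_Icc {N : ℝ → ℝ} (hN : AnalyticAt ℝ N 0) (hN' : 0 < deriv N 0) :
    ∃ δ > 0, StrictMonoOn N (Icc 0 δ) := by
  have hev : ∀ᶠ u in 𝓝 (0 : ℝ), AnalyticAt ℝ N u ∧ 0 < deriv N u :=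
    hN.eventually_analyticAt.and (hN.deriv.continuousAt.eventually_const_lt hN')
  obtain ⟨ε, hε, hball⟩ := Metric.eventually_nhds_iff.1 hev
  have hmem : ∀ u ∈ Icc 0 (ε / 2), AnalyticAt ℝ N u ∧ 0 < deriv N u := fun u hu => hball (by
    rw [Real.dist_eq, sub_zero, abs_of_nonneg hu.1]
    linarith [hu.2])
  refine ⟨ε / 2, by positivity, strictMonoOn_of_deriv_pos (convex_Icc _ _)
    (fun u hu => (hmem u hu).1.continuousAt.continuousWithinAt) fun u hu => ?_⟩
  exact (hmem u (interior_subset hu)).2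

/-- If the action form of a planar map is a function `N` of the action, then `N` is increasing. -/
theorem deriv_pos_of_action_eq {Q : ℝ × ℝ → ℝ × ℝ} {N : ℝ → ℝ} (hN : AnalyticAt ℝ N 0)
    (hN0 : N 0 = 0) (hN' : deriv N 0 ≠ 0)
    (hQN : ∀ᶠ z in 𝓝 (0 : ℝ × ℝ), ((Q z).1 ^ 2 + (Q z).2 ^ 2) / 2 = N ((z.1 ^ 2 + z.2 ^ 2) / 2)) :
    0 < deriv N 0 := by
  refine (lt_or_gt_of_ne hN').resolve_left fun hneg => ?_
  -- If N'(0) < 0, then N is negative just right of 0, yet its values there are actions of points Q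
  -- z.
  obtain ⟨δ, hδ, hmono⟩ := exists_strictMonoOn_Icc hN.neg (by simpa using hneg)
  obtain ⟨ε, hε, hsub⟩ := exists_actionDisc_subset hQN
  set v := min δ (ε / 2) with hv
  have hv0 : 0 < v := lt_min hδ (by positivity)
  have hvε : v < ε := (min_le_right _ _).trans_lt (by linarith)
  have hact : (Real.sqrt (2 * v) ^ 2 + (0 : ℝ) ^ 2) / 2 = v := by
    rw [Real.sq_sqrt (by linarith)]
    ring
  have h1 := hsub (show (Real.sqrt (2 * v), (0 : ℝ)) ∈ actionDisc ε from hact.trans_lt hvε)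
  simp only [mem_ofPred_eq, hact] at h1
  have h2 := hmono (left_mem_Icc.2 hδ.le) ⟨hv0.le, min_le_left _ _⟩ hv0
  simp only [Pi.neg_apply, hN0, neg_zero] at h2
  have h3 : 0 ≤ N v := h1 ▸ by positivity
  linarith

/-- Let `Q` be a local diffeomorphism of the plane which takes the action to a function `N` of the
action. If the density `F` pulls back to the standard area, then the disc of action `N u` has
`F`-area `2 π u`. -/
theorem eventually_area_actionDisc {Q : ℝ × ℝ → ℝ × ℝ} {F : ℝ × ℝ → ℝ} {N : ℝ → ℝ}
    (hQ : AnalyticAt ℝ Q 0) (hQ0 : Q 0 = 0) (hdet : (fderiv ℝ Q 0).det ≠ 0)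
    (hN : AnalyticAt ℝ N 0) (hN0 : N 0 = 0) (hN' : deriv N 0 ≠ 0)
    (hQN : ∀ᶠ z in 𝓝 (0 : ℝ × ℝ), ((Q z).1 ^ 2 + (Q z).2 ^ 2) / 2 = N ((z.1 ^ 2 + z.2 ^ 2) / 2))
    (hF : ∀ᶠ z in 𝓝 (0 : ℝ × ℝ), |(fderiv ℝ Q z).det| * F (Q z) = 1) :
    ∀ᶠ u in 𝓝[>] (0 : ℝ), 0 < N u ∧ 2 * Real.pi * u = ∫ w in actionDisc (N u), F w := by
  have hstrict : HasStrictFDerivAt Q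
      ((fderiv ℝ Q 0).toContinuousLinearEquivOfDetNeZero hdet : ℝ × ℝ →L[ℝ] ℝ × ℝ) 0 := by
    rw [ContinuousLinearMap.coe_toContinuousLinearEquivOfDetNeZero]
    exact hQ.hasStrictFDerivAt
  obtain ⟨δ, hδ, hmono⟩ :=
    exists_strictMonoOn_Icc hN (deriv_pos_of_action_eq hN hN0 hN' hQN)
  have hsource : ∀ᶠ z in 𝓝 (0 : ℝ × ℝ), z ∈ (hstrict.toOpenPartialHomeomorph Q).source :=
    (hstrict.toOpenPartialHomeomorph Q).open_source.mem_nhds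
      hstrict.mem_toOpenPartialHomeomorph_source
  obtain ⟨ε', hε', hsub⟩ := exists_actionDisc_subset
    (hsource.and (hQ.eventually_analyticAt.and (hQN.and hF)))
  set ε := min δ ε' with hε
  have hε0 : 0 < ε := lt_min hδ hε'
  have hgood : ∀ z ∈ actionDisc ε, z ∈ (hstrict.toOpenPartialHomeomorph Q).source ∧
      AnalyticAt ℝ Q z ∧ ((Q z).1 ^ 2 + (Q z).2 ^ 2) / 2 = N ((z.1 ^ 2 + z.2 ^ 2) / 2) ∧
      |(fderiv ℝ Q z).det| * F (Q z) = 1 :=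
    fun z hz => hsub (actionDisc_mono (min_le_right _ _) hz)
  have hIcc : ∀ z ∈ actionDisc ε, (z.1 ^ 2 + z.2 ^ 2) / 2 ∈ Icc 0 δ := fun z hz =>
    ⟨by positivity, (lt_of_lt_of_le hz (min_le_left _ _)).le⟩
  -- Openness of Q at 0 makes small target discs lie in the image, which supplies the surjectivity
  -- in `himage`.
  have himg : Q '' actionDisc ε ∈ 𝓝 (0 : ℝ × ℝ) := by
    have h := image_mem_map (m := Q) ((isOpen_actionDisc ε).mem_nhds
      (show (0 : ℝ × ℝ) ∈ actionDisc ε by simpa [actionDisc] using hε0))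
    rwa [hstrict.map_nhds_eq_of_equiv, hQ0] at h
  obtain ⟨η, hη, hηsub⟩ := exists_actionDisc_subset himg
  have hNη : ∀ᶠ u in 𝓝 (0 : ℝ), N u < η :=
    hN.continuousAt.eventually_lt_const (by rwa [hN0])
  filter_upwards [self_mem_nhdsWithin, nhdsWithin_le_nhds hNη,
    nhdsWithin_le_nhds (Iio_mem_nhds hε0)] with u (hu : 0 < u) huη (huε : u < ε)
  have huI : u ∈ Icc 0 δ := ⟨hu.le, (huε.trans_le (min_le_left _ _)).le⟩
  have hsubu : actionDisc u ⊆ actionDisc ε := actionDisc_mono huε.le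
  have himage : Q '' actionDisc u = actionDisc (N u) := by
    ext w
    constructor
    · rintro ⟨z, hz, rfl⟩
      show ((Q z).1 ^ 2 + (Q z).2 ^ 2) / 2 < N u
      rw [(hgood z (hsubu hz)).2.2.1]
      exact hmono (hIcc z (hsubu hz)) huI hz
    · intro hw
      obtain ⟨z, hz, rfl⟩ := hηsub (actionDisc_mono huη.le hw)
      refine ⟨z, (hmono.lt_iff_lt (hIcc z hz) huI).1 ?_, rfl⟩
      rw [← (hgood z hz).2.2.1]
      exact hw
  have hinj : InjOn Q (actionDisc u) := fun x hx y hy hxy =>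
    (hstrict.toOpenPartialHomeomorph Q).injOn (hgood x (hsubu hx)).1 (hgood y (hsubu hy)).1 hxy
  have harea : ∫ _z in actionDisc u, (1 : ℝ) = 2 * Real.pi * u := by
    rw [setIntegral_disc_eq_integral_action (G := fun _ => 2 * Real.pi) hu.le continuousOn_const
      continuousOn_const fun r => by
        rw [intervalIntegral.integral_const, smul_eq_mul]
        ring]
    rw [intervalIntegral.integral_const, smul_eq_mul]
    ring
  refine ⟨hN0 ▸ hmono (left_mem_Icc.2 hδ.le) huI hu, ?_⟩
  rw [← himage, integral_image_eq_integral_abs_det_fderiv_smul volume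
    (isOpen_actionDisc u).measurableSet (fun z hz =>
      (hgood z (hsubu hz)).2.1.differentiableAt.hasFDerivAt.hasFDerivWithinAt) hinj, ← harea]
  refine setIntegral_congr_fun (isOpen_actionDisc u).measurableSet fun z hz => ?_
  exact (hgood z (hsubu hz)).2.2.2.symm

/-! ### Differentiating the area relation and inverting the germ. -/

/-- A germ `N` for which `∫₀^{N u} G = κ u` when `u > 0` has a local inverse with derivative
`G / κ`, on both sides of the origin. -/
theorem IsLocalInverse.eventually_hasDerivAt {N Φ G : ℝ → ℝ} {κ : ℝ} (hNΦ : IsLocalInverse N Φ)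
    (hN : AnalyticAt ℝ N 0) (hN0 : N 0 = 0) (hN' : deriv N 0 ≠ 0) (hG : AnalyticAt ℝ G 0)
    (hκ : κ ≠ 0) (hint : ∀ᶠ u in 𝓝[>] (0 : ℝ), κ * u = ∫ s in (0 : ℝ)..N u, G s) :
    ∀ᶠ t in 𝓝 (0 : ℝ), HasDerivAt Φ (G t / κ) t := by
  have hNt : Tendsto N (𝓝 0) (𝓝 0) := by simpa [hN0] using hN.continuousAt.tendsto
  obtain ⟨ρ, hρ, hGρ⟩ := Metric.eventually_nhds_iff_ball.1 hG.eventually_analyticAt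
  have hpos : ∀ᶠ u in 𝓝[>] (0 : ℝ), G (N u) * deriv N u = κ := by
    filter_upwards [self_mem_nhdsWithin, eventually_eventually_nhdsWithin.2 hint,
      nhdsWithin_le_nhds hN.eventually_analyticAt,
      nhdsWithin_le_nhds (hNt.eventually (Metric.ball_mem_nhds 0 hρ))]
      with u hu hintu hNu (hball : N u ∈ Metric.ball 0 ρ)
    rw [IsOpen.nhdsWithin_eq isOpen_Ioi hu] at hintu
    have hseg : uIcc 0 (N u) ⊆ Metric.ball 0 ρ := by
      rw [Real.ball_eq_Ioo] at hball ⊢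
      exact ordConnected_Ioo.uIcc_subset (by constructor <;> linarith) hball
    have hGc : ContinuousOn G (Metric.ball 0 ρ) := fun s hs =>
      (hGρ s hs).continuousAt.continuousWithinAt
    have hFTC := intervalIntegral.integral_hasDerivAt_right
      ((hGc.mono hseg).intervalIntegrable)
      (hGc.stronglyMeasurableAtFilter Metric.isOpen_ball _ hball)
      (hGρ _ hball).continuousAt
    have h1 := hFTC.comp u hNu.differentiableAt.hasDerivAt
    have h2 : HasDerivAt (fun v => κ * v) κ u := by
      simpa using (hasDerivAt_id u).const_mul κ
    exact h1.unique (h2.congr_of_eventuallyEq (hintu.mono fun v hv => hv.symm))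
  -- Both sides are analytic at 0 and agree for small u > 0, hence on both sides of 0.
  have hall : ∀ᶠ u in 𝓝 (0 : ℝ), G (N u) * deriv N u = κ := by
    refine (AnalyticAt.frequently_eq_iff_eventually_eq ((hG.comp_of_eq hN hN0).mul hN.deriv)
      analyticAt_const).1 ?_
    exact hpos.frequently.filter_mono (nhdsWithin_mono _ fun x hx => ne_of_gt hx)
  have hderiv : ∀ᶠ u in 𝓝 (0 : ℝ), deriv N u ≠ 0 := hN.deriv.continuousAt.eventually_ne hN'
  have hmap : ∀ u, AnalyticAt ℝ N u → deriv N u ≠ 0 → map N (𝓝 u) = 𝓝 (N u) := fun u hu hu' =>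
    hu.hasStrictDerivAt.map_nhds_eq hu'
  have hΦt : Tendsto Φ (𝓝 0) (𝓝 0) := by
    have h0 := hmap 0 hN hN'
    rw [hN0] at h0
    suffices h : Tendsto Φ (map N (𝓝 0)) (𝓝 0) by rwa [h0] at h
    rw [tendsto_map'_iff]
    exact tendsto_id.congr' (hNΦ.2.1.mono fun u hu => hu.symm)
  -- No regularity of Φ is assumed: N maps neighbourhoods of u onto neighbourhoods of N u, and Φ ∘ N
  -- is the identity near u.
  have hΦcont : ∀ᶠ u in 𝓝 (0 : ℝ), ContinuousAt Φ (N u) := by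
    filter_upwards [eventually_eventually_nhds.2 hNΦ.2.1, hN.eventually_analyticAt, hderiv]
      with u hu hNu hu'
    rw [ContinuousAt, ← hmap u hNu hu', tendsto_map'_iff, hu.self_of_nhds]
    exact tendsto_id.congr' (hu.mono fun v hv => hv.symm)
  filter_upwards [hΦt.eventually hall, hΦt.eventually hderiv, hΦt.eventually hΦcont,
    hΦt.eventually hN.eventually_analyticAt, eventually_eventually_nhds.2 hNΦ.2.2]
    with t h1 h2 h3 h4 h5
  have ht : N (Φ t) = t := h5.self_of_nhds
  rw [ht] at h1 h3
  have h6 := HasDerivAt.of_local_left_inverse h3 h4.differentiableAt.hasDerivAt h2 h5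
  have hval : G t / κ = (deriv N (Φ t))⁻¹ := by
    have : G t ≠ 0 := fun h => hκ (by rw [← h1, h, zero_mul])
    rw [← h1]
    field_simp
  rwa [hval]

/-! ### The rigid body in energy coordinates. -/

theorem continuousLinearMap_det_prod (L : ℝ × ℝ →L[ℝ] ℝ × ℝ) :
    L.det = (L (1, 0)).1 * (L (0, 1)).2 - (L (0, 1)).1 * (L (1, 0)).2 := by
  rw [ContinuousLinearMap.det, ← LinearMap.det_toMatrix (Module.Basis.finTwoProd ℝ),
    Matrix.det_fin_two]
  simp [LinearMap.toMatrix_apply]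

/-- The density of the orbit symplectic form in the coordinates `(√A p₁, √B p₂)`. -/
def orbitDensity (A B l : ℝ) (w : ℝ × ℝ) : ℝ :=
  1 / (3 * Real.sqrt (A * B) * Real.sqrt (2 * l - (w.1 ^ 2 / A + w.2 ^ 2 / B)))

theorem integral_orbitDensity_circle (A B l r : ℝ) :
    ∫ θ in (-Real.pi)..Real.pi, orbitDensity A B l (r * Real.cos θ, r * Real.sin θ)
      = levelPeriod A B l (r ^ 2 / 2) := by
  unfold levelPeriod orbitDensity
  refine intervalIntegral.integral_congr fun θ _ => ?_
  simp only
  congr 4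
  ring

/-- The radicand stays positive because w₁²/A + w₂²/B ≤ |w|²/min(A, B) < 2l. -/
theorem continuousOn_orbitDensity {A B l T : ℝ} (hA : 0 < A) (hB : 0 < B)
    (hTA : T < l * A) (hTB : T < l * B) :
    ContinuousOn (orbitDensity A B l) {w | (w.1 ^ 2 + w.2 ^ 2) / 2 ≤ T} := by
  refine continuousOn_const.div (by fun_prop) fun w hw => ?_
  replace hw : (w.1 ^ 2 + w.2 ^ 2) / 2 ≤ T := hw
  have h1 : w.1 ^ 2 / A + w.2 ^ 2 / B < 2 * l := by
    rw [div_add_div _ _ hA.ne' hB.ne', div_lt_iff₀ (mul_pos hA hB)]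
    rcases le_total A B with h | h
    · nlinarith [mul_le_mul_of_nonneg_right h (sq_nonneg w.2),
        mul_lt_mul_of_pos_right (hw.trans_lt hTA) hB]
    · nlinarith [mul_le_mul_of_nonneg_right h (sq_nonneg w.1),
        mul_lt_mul_of_pos_right (hw.trans_lt hTB) hA]
  have h2 := Real.sqrt_pos.2 (sub_pos.2 h1)
  have h3 := Real.sqrt_pos.2 (mul_pos hA hB)
  positivity

/-- The derivative of a parametrisation of the sphere takes values in the tangent space. -/
theorem tangent_of_casimir_eq {l : ℝ} {P : ℝ × ℝ → Fin 3 → ℝ} {z : ℝ × ℝ}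
    (hP : DifferentiableAt ℝ P z) (hcas : ∀ᶠ y in 𝓝 z, casimir (P y) = l) (v : ℝ × ℝ) :
    P z 0 * fderiv ℝ P z v 0 + P z 1 * fderiv ℝ P z v 1 + P z 2 * fderiv ℝ P z v 2 = 0 := by
  have hi := hasFDerivAt_pi'.1 hP.hasFDerivAt
  have h := ((((hi 0).pow 2).add ((hi 1).pow 2)).add ((hi 2).pow 2)).mul_const (2⁻¹ : ℝ)
  have h0 : HasFDerivAt (fun y => casimir (P y)) (0 : ℝ × ℝ →L[ℝ] ℝ) z :=
    (hasFDerivAt_const l z).congr_of_eventuallyEq hcas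
  have := congrArg (fun L : ℝ × ℝ →L[ℝ] ℝ => L v) (h.unique h0)
  simp at this
  linarith

/-- The momentum coordinates `(√A p₁, √B p₂)` along a parametrisation `P`, in which the energy
is the action. -/
def energyCoord (A B : ℝ) (P : ℝ × ℝ → Fin 3 → ℝ) (z : ℝ × ℝ) : ℝ × ℝ :=
  (Real.sqrt A * P z 0, Real.sqrt B * P z 1)

theorem analyticAt_energyCoord {A B : ℝ} {P : ℝ × ℝ → Fin 3 → ℝ} {z : ℝ × ℝ}
    (hP : AnalyticAt ℝ P z) : AnalyticAt ℝ (energyCoord A B P) z := by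
  have hi : ∀ i, AnalyticAt ℝ (fun y => P y i) z := analyticAt_pi_iff.1 hP
  exact (analyticAt_const.mul (hi 0)).prod (analyticAt_const.mul (hi 1))

theorem det_fderiv_energyCoord {A B : ℝ} {P : ℝ × ℝ → Fin 3 → ℝ} {z : ℝ × ℝ}
    (hP : DifferentiableAt ℝ P z) :
    (fderiv ℝ (energyCoord A B P) z).det = Real.sqrt A * Real.sqrt B *
      (fderiv ℝ P z (1, 0) 0 * fderiv ℝ P z (0, 1) 1
        - fderiv ℝ P z (1, 0) 1 * fderiv ℝ P z (0, 1) 0) := by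
  have hi := hasFDerivAt_pi'.1 hP.hasFDerivAt
  have h : HasFDerivAt (energyCoord A B P) _ z :=
    ((hi 0).const_mul (Real.sqrt A)).prodMk ((hi 1).const_mul (Real.sqrt B))
  rw [h.fderiv, continuousLinearMap_det_prod]
  simp
  ring

/-- A Darboux parametrisation turns the orbit density into the standard area. -/
theorem abs_det_mul_orbitDensity {A B l : ℝ} (hA : 0 < A) (hB : 0 < B) (hl : 0 < l)
    {P : ℝ × ℝ → Fin 3 → ℝ} {z : ℝ × ℝ} (hP : DifferentiableAt ℝ P z)
    (hcas : ∀ᶠ y in 𝓝 z, casimir (P y) = l)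
    (hform : orbitForm l (P z) (fderiv ℝ P z (1, 0)) (fderiv ℝ P z (0, 1)) = 1)
    (hP2 : P z 2 ≠ 0) :
    |(fderiv ℝ (energyCoord A B P) z).det| * orbitDensity A B l (energyCoord A B P z) = 1 := by
  have hc : casimir (P z) = l := hcas.self_of_nhds
  have h1 := (orbitForm_eq hl hc (tangent_of_casimir_eq hP hcas (1, 0))
    (tangent_of_casimir_eq hP hcas (0, 1))).1 hP2
  rw [hform, eq_div_iff (by positivity), one_mul] at h1
  rw [det_fderiv_energyCoord hP, ← h1, ← Real.sqrt_mul hA.le, abs_mul, abs_mul,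
    abs_of_nonneg (Real.sqrt_nonneg _), abs_of_pos (three_pos : (0 : ℝ) < 3)]
  -- The radicand is p₃², whose root is |p₃|; with the absolute value of the determinant this treats
  -- both poles at once.
  have h2 : 2 * l - ((Real.sqrt A * P z 0) ^ 2 / A + (Real.sqrt B * P z 1) ^ 2 / B)
      = P z 2 ^ 2 := by
    rw [mul_pow, mul_pow, Real.sq_sqrt hA.le, Real.sq_sqrt hB.le,
      mul_div_cancel_left₀ _ hA.ne', mul_div_cancel_left₀ _ hB.ne', ← hc, casimir]
    ring
  have h3 := Real.sqrt_pos.2 (mul_pos hA hB)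
  have h4 := abs_pos.2 hP2
  simp only [orbitDensity, energyCoord]
  rw [h2, Real.sqrt_sq_eq_abs]
  field_simp

/-- Subtracting `casimir`/I₃ from the Hamiltonian removes p₃, and the constant l/I₃ is the energy of
e. -/
theorem energyCoord_action {I₁ I₂ I₃ l : ℝ} {P : ℝ × ℝ → Fin 3 → ℝ} {z : ℝ × ℝ}
    {e : Fin 3 → ℝ} (hA : 0 ≤ 1 / I₁ - 1 / I₃) (hB : 0 ≤ 1 / I₂ - 1 / I₃)
    (he0 : e 0 = 0) (he1 : e 1 = 0) (he2 : e 2 ^ 2 = 2 * l) (hcas : casimir (P z) = l) :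
    ((energyCoord (1 / I₁ - 1 / I₃) (1 / I₂ - 1 / I₃) P z).1 ^ 2
      + (energyCoord (1 / I₁ - 1 / I₃) (1 / I₂ - 1 / I₃) P z).2 ^ 2) / 2
      = hamiltonian I₁ I₂ I₃ (P z) - hamiltonian I₁ I₂ I₃ e := by
  simp only [energyCoord, hamiltonian, he0, he1, he2, mul_pow, Real.sq_sqrt hA, Real.sq_sqrt hB]
  unfold casimir at hcas
  linear_combination (-1 / I₃) * hcas

/-- The derivative of the inverse normal form around the equilibrium on the third axis, on both
sides of the equilibrium energy. -/
theorem eventually_hasDerivAt_inverse_normalForm {I₁ I₂ I₃ l : ℝ} {e : Fin 3 → ℝ} {N Φ : ℝ → ℝ}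
    (hA : 0 < 1 / I₁ - 1 / I₃) (hB : 0 < 1 / I₂ - 1 / I₃) (hl : 0 < l)
    (he0 : e 0 = 0) (he1 : e 1 = 0) (he2 : e 2 ^ 2 = 2 * l)
    (hN : IsBirkhoffNormalForm I₁ I₂ I₃ l e N) (hΦ : IsLocalInverse N Φ) :
    ∀ᶠ t in 𝓝 (0 : ℝ), HasDerivAt Φ
      (levelPeriod (1 / I₁ - 1 / I₃) (1 / I₂ - 1 / I₃) l t / (2 * Real.pi)) t := by
  obtain ⟨hNa, hN0, hN', P, hP, hH⟩ := hN
  set A := 1 / I₁ - 1 / I₃ with hAdef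
  set B := 1 / I₂ - 1 / I₃ with hBdef
  have hPa : AnalyticAt ℝ P (0 : ℝ × ℝ) := hP.analyticAt
  have he2' : e 2 ≠ 0 := fun h => by
    rw [h] at he2
    linarith
  have hP2 : ∀ᶠ z in 𝓝 (0 : ℝ × ℝ), P z 2 ≠ 0 := by
    have hc : ContinuousAt (fun z => P z 2) (0 : ℝ × ℝ) :=
      (analyticAt_pi_iff.1 hPa 2).continuousAt
    refine hc.eventually_ne ?_
    rw [← Prod.mk_zero_zero, hP.map_zero]
    exact he2'
  have hF : ∀ᶠ z in 𝓝 (0 : ℝ × ℝ),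
      |(fderiv ℝ (energyCoord A B P) z).det| * orbitDensity A B l (energyCoord A B P z) = 1 := by
    filter_upwards [hPa.eventually_analyticAt, eventually_eventually_nhds.2 hP.casimir_eq,
      hP.pullback_eq, hP2] with z h1 h2 h3 h4
    exact abs_det_mul_orbitDensity hA hB hl h1.differentiableAt h2 h3 h4
  have hQN : ∀ᶠ z in 𝓝 (0 : ℝ × ℝ),
      ((energyCoord A B P z).1 ^ 2 + (energyCoord A B P z).2 ^ 2) / 2
        = N ((z.1 ^ 2 + z.2 ^ 2) / 2) := by
    filter_upwards [hP.casimir_eq, hH] with z h1 h2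
    rw [← h2]
    exact energyCoord_action hA.le hB.le he0 he1 he2 h1
  have hQ0 : energyCoord A B P 0 = 0 := by
    have h : P (0 : ℝ × ℝ) = e := hP.map_zero
    simp [energyCoord, h, he0, he1]
  -- The Darboux condition already forces invertibility: a zero determinant would contradict `hF` at
  -- the origin.
  have hdet : (fderiv ℝ (energyCoord A B P) 0).det ≠ 0 := fun h => by
    have := hF.self_of_nhds
    rw [h, abs_zero, zero_mul] at this
    exact zero_ne_one this
  have harea := eventually_area_actionDisc (analyticAt_energyCoord hPa) hQ0 hdet hNa hN0 hN' hQN hF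
  have hG := analyticAt_levelPeriod hA hB hl
  refine hΦ.eventually_hasDerivAt hNa hN0 hN' hG (by positivity) ?_
  obtain ⟨ρ, hρ, hGρ⟩ := Metric.eventually_nhds_iff_ball.1 hG.eventually_analyticAt
  have hsmall : ∀ᶠ u in 𝓝 (0 : ℝ), N u < ρ ∧ N u < l * A ∧ N u < l * B := by
    have hc : ContinuousAt N 0 := hNa.continuousAt
    rw [ContinuousAt, hN0] at hc
    exact (hc.eventually_lt_const hρ).and
      ((hc.eventually_lt_const (mul_pos hl hA)).and (hc.eventually_lt_const (mul_pos hl hB)))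
  filter_upwards [harea, nhdsWithin_le_nhds hsmall] with u hu ⟨h1, h2, h3⟩
  rw [hu.2]
  refine setIntegral_disc_eq_integral_action hu.1.le (continuousOn_orbitDensity hA hB h2 h3)
    (fun s hs => (hGρ s ?_).continuousAt.continuousWithinAt)
    (integral_orbitDensity_circle A B l)
  rw [mem_ball_zero_iff, Real.norm_of_nonneg hs.1]
  exact hs.2.trans_lt h1

/-! ### Closed form in a, b, c, d and conclusion. -/

/-- The period along a level curve, in terms of the ratio `d` of energy and Casimir. -/
theorem levelPeriod_div_two_pi {a b c d l : ℝ} (hca : c < a) (hcb : c < b) (hda : d < a)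
    (hdb : d < b) (hl : 0 < l) :
    levelPeriod (a - c) (b - c) l (l * (d - c)) / (2 * Real.pi)
      = 1 / (3 * Real.pi) * Real.sqrt (2 / l) * (1 / Real.sqrt ((d - a) * (c - b)))
        * ellipticK ((d - c) * (b - a) / ((d - a) * (b - c))) := by
  have hA : 0 < a - c := sub_pos.2 hca
  have hB : 0 < b - c := sub_pos.2 hcb
  have hD : 0 < a - d := sub_pos.2 hda
  have hX : 0 < (d - a) * (c - b) := mul_pos_of_neg_of_neg (by linarith) (by linarith)
  rw [levelPeriod_eq_ellipticK hA hB (by nlinarith) (by nlinarith)]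
  have hm : l * (d - c) * (1 / (b - c) - 1 / (a - c)) / (l - l * (d - c) / (a - c))
      = (d - c) * (b - a) / ((d - a) * (b - c)) := by
    have h1 : l - l * (d - c) / (a - c) = l * (a - d) / (a - c) := by
      field_simp
      ring
    have h2 : d - a ≠ 0 := by linarith
    rw [h1]
    field_simp
    ring
  have hroot : Real.sqrt ((a - c) * (b - c)) * Real.sqrt (2 * l - 2 * (l * (d - c)) / (a - c))
      = Real.sqrt (2 * l) * Real.sqrt ((d - a) * (c - b)) := by
    rw [← Real.sqrt_mul (by positivity), ← Real.sqrt_mul (by positivity)]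
    congr 1
    field_simp
    ring
  -- Trades the factor 2/√(2l) for the √(2/l) of the stated formula.
  have htwo : Real.sqrt (2 / l) * Real.sqrt (2 * l) = 2 := by
    rw [← Real.sqrt_mul (by positivity), show 2 / l * (2 * l) = 2 ^ 2 by field_simp,
      Real.sqrt_sq (by norm_num)]
  have h2l : 0 < Real.sqrt (2 * l) := Real.sqrt_pos.2 (by positivity)
  have hXs := Real.sqrt_pos.2 hX
  rw [hm, mul_assoc 3, hroot, eq_div_of_mul_eq h2l.ne' htwo]
  field_simp
  norm_num

end FreeRigidBody

end

theorem corollary4p3 (I₁ I₂ I₃ l : ℝ) (hI₁ : 0 < I₁) (hI₁₂ : I₁ < I₂) (hI₂₃ : I₂ < I₃)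
    (hl : 0 < l) (e : Fin 3 → ℝ)
    (he : e = ![0, 0, Real.sqrt (2 * l)] ∨ e = ![0, 0, -Real.sqrt (2 * l)])
    (N₃ Φ₃ : ℝ → ℝ) (hN : FreeRigidBody.IsBirkhoffNormalForm I₁ I₂ I₃ l e N₃)
    (hΦ : FreeRigidBody.IsLocalInverse N₃ Φ₃) (a b c : ℝ)
    (ha : a = 1 / I₁) (hb : b = 1 / I₂) (hc : c = 1 / I₃) :
    ∀ᶠ h in nhds (l / I₃), ∀ d : ℝ, d = h / l →
      HasDerivAt (fun t : ℝ => (Φ₃ t : ℂ))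
        (-(1 / (3 * (Real.pi : ℂ))) * (Real.sqrt (2 / l) : ℂ)
          * (1 / FreeRigidBody.rootMul (d - a) (c - b))
          * (FreeRigidBody.ellipticK ((d - c) * (b - a) / ((d - a) * (b - c))) : ℂ))
        (h - l / I₃) ∧
      -(1 / (3 * (Real.pi : ℂ))) * (Real.sqrt (2 / l) : ℂ)
          * (1 / FreeRigidBody.rootMul (d - a) (c - b))
          * (FreeRigidBody.ellipticK ((d - c) * (b - a) / ((d - a) * (b - c))) : ℂ)
        = FreeRigidBody.periodS l c b a d := by
  have hsq : Real.sqrt (2 * l) ^ 2 = 2 * l := Real.sq_sqrt (by positivity)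
  have he' : e 0 = 0 ∧ e 1 = 0 ∧ e 2 ^ 2 = 2 * l := by
    rcases he with rfl | rfl <;> simpa [-Real.sqrt_mul, -Nat.ofNat_nonneg] using hsq
  have hI₂ : 0 < I₂ := hI₁.trans hI₁₂
  have hca : c < a := by
    rw [ha, hc]
    exact one_div_lt_one_div_of_lt hI₁ (hI₁₂.trans hI₂₃)
  have hcb : c < b := by
    rw [hb, hc]
    exact one_div_lt_one_div_of_lt hI₂ hI₂₃
  have hderiv := FreeRigidBody.eventually_hasDerivAt_inverse_normalForm
    (by rw [← ha, ← hc]; linarith) (by rw [← hb, ← hc]; linarith) hl he'.1 he'.2.1 he'.2.2 hN hΦ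
  rw [← ha, ← hb, ← hc] at hderiv
  have hshift : Tendsto (fun h : ℝ => h - l / I₃) (𝓝 (l / I₃)) (𝓝 0) := by
    have : ContinuousAt (fun h : ℝ => h - l / I₃) (l / I₃) := by fun_prop
    simpa [ContinuousAt] using this
  have hlc : l / I₃ = l * c := by rw [hc]; ring
  filter_upwards [hshift.eventually hderiv,
    Iio_mem_nhds (show l / I₃ < l * a by rw [hlc]; gcongr),
    Iio_mem_nhds (show l / I₃ < l * b by rw [hlc]; gcongr)] with h hh
    (hha : h < l * a) (hhb : h < l * b) d hd
  -- Substituting (c, b, a, d) in `periodS` gives the same expression verbatim.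
  refine ⟨?_, rfl⟩
  have hda : d < a := by rwa [hd, div_lt_iff₀' hl]
  have hdb : d < b := by rwa [hd, div_lt_iff₀' hl]
  have ht : h - l / I₃ = l * (d - c) := by
    rw [hd, hlc]
    field_simp
  rw [ht] at hh ⊢
  rw [FreeRigidBody.levelPeriod_div_two_pi hca hcb hda hdb hl] at hh
  -- Both factors are negative, so the branch contributes a minus sign that cancels the leading one.
  have hroot := FreeRigidBody.rootMul_of_neg (sub_neg.2 hda) (sub_neg.2 hcb)
  rw [hroot]
  convert hh.ofReal_comp using 1
  push_cast
  ring
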